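/- **Theorem.** For a vector $(\beta_1^{(0)},\beta_2^{(0)},\beta_3^{(0)})\in\mathbb R^3$, its Jacobi–Perron (JPA) expansion is the sequence of vectors given by $$\beta^{(k+1)}=\left(\beta_2^{(k)}-\left\lfloor \frac{\beta_2^{(k)}}{\beta_1^{(k)}}\right\rfloor\beta_1^{(k)},\ \beta_3^{(k)}-\left\lfloor \frac{\beta_3^{(k)}}{\beta_1^{(k)}}\right\rfloor\beta_1^{(k)},\ \beta_1^{(k)}\right).$$ For real numbers $\gamma_1,\gamma_2,\dots$ let $\langle\gamma_1,\gamma_2,\ldots\rangle$ denote the additive group they generate, and let $N$ denote the norm from the cubic field in question to $\mathbb Q$. (1) Let $a\ge 3$ be an integer, let $K=\mathbb Q(\rho)$ with $\rho$ a root of $x^3+(a-1)x^2-ax-1$, and let $$S=\{-v-(a(v-1)+w)\rho+(a(v-1)+w+1)\rho^2 \;:\; v,w\in\mathbb Z,\ 1\le v\le a-1,\ \max\{1,v-1\}\le w\le a-1\}.$$ Let $\tau$ be one of the roots of the same polynomial, let $\sigma:K\to\mathbb R$ be the embedding with $\sigma(\rho)=\tau$, and let $\langle\beta^{(k)}\rangle_{k\ge0}$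 be the JPA expansion of $(1,|\tau|,\tau^2)$. Let $k\ge 0$ and let $\varepsilon$ be a unit of the ring of integers of $\mathbb Q(\tau)$ such that $$L:=\langle\alpha-\beta \mid \alpha,\beta\in\sigma(S)\rangle=\langle\beta_1^{(k)}\varepsilon,\beta_2^{(k)}\varepsilon\rangle\quad\text{and}\quad |N(\beta_3^{(k)})|\le a^2-5a .$$ Then, after replacing $\varepsilon$ by $-\varepsilon$ if necessary, $\sigma(S)\subset\beta_3^{(k)}\varepsilon+L$. (2) Let $a\ge 5$ be an integer, let $K=\mathbb Q(\psi)$ with $\psi$ a root of $x^3-(a-1)x^2-ax-1$, and let $$\tilde S=\{1+v-u+au+(a-u+au)\psi-(u+1)\psi^2 \;:\; v,u\in\mathbb Z,\ 1\le v\le a-3,\ 0\le u\le v,\ (v,u)\ne(1,0)\}.$$ Let $\tau$ be one of the roots of the same polynomial, let $\sigma:K\to\mathbb R$ be the embedding with $\sigma(\psi)=\tau$, and let $\langle\beta^{(k)}\rangle_{k\ge0}$ be the JPA expansion of $(1,|\tau|,\tau^2)$. Let $k\ge 0$ and let $\varepsilon$ be a unit of the ring of integers of $\mathbb Q(\tau)$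 such that $$L:=\langle\alpha-\beta \mid \alpha,\beta\in\sigma(\tilde S)\rangle=\langle\beta_1^{(k)}\varepsilon,\beta_2^{(k)}\varepsilon\rangle\quad\text{and}\quad |N(\beta_3^{(k)})|\le a^2-5a .$$ Then, after replacing $\varepsilon$ by $-\varepsilon$ if necessary, $\sigma(\tilde S)\subset\beta_3^{(k)}\varepsilon+L$. -/

import Mathlib

open NumberField

/-- One step of the homogeneous Jacobi--Perron algorithm on a vector `β = (β₁, …, βₙ₊₁)`
(indexed here by `0, …, n`):
`(β₂ - ⌊β₂/β₁⌋ β₁, …, βₙ₊₁ - ⌊βₙ₊₁/β₁⌋ β₁, β₁)`. -/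
noncomputable def jpaStep {n : ℕ} (β : Fin (n + 1) → ℝ) : Fin (n + 1) → ℝ :=
  Fin.snoc (α := fun _ => ℝ)
    (fun i : Fin n => β i.succ - (⌊β i.succ / β 0⌋ : ℝ) * β 0) (β 0)

/-- The Jacobi--Perron expansion `⟨β⁽ᵏ⁾⟩` of the vector `β`. -/
noncomputable def jpa {n : ℕ} (β : Fin (n + 1) → ℝ) (k : ℕ) : Fin (n + 1) → ℝ :=
  jpaStep^[k] β

theorem jpa_mem {n : ℕ} (F : Subfield ℝ) (β : Fin (n + 1) → ℝ) (hβ : ∀ i, β i ∈ F)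
    (k : ℕ) (i : Fin (n + 1)) : jpa β k i ∈ F := by
  induction k generalizing i with
  | zero => exact hβ i
  | succ k ih =>
    have h : jpa β (k + 1) = jpaStep (jpa β k) := Function.iterate_succ_apply' _ _ _
    rw [h, jpaStep]
    refine Fin.lastCases ?_ (fun j => ?_) i
    · rw [Fin.snoc_last]
      exact ih 0
    · rw [Fin.snoc_castSucc]
      exact F.sub_mem (ih _) (F.mul_mem (intCast_mem F _) (ih 0))

theorem initial_mem {K : Type*} [Field K] (σ : K →+* ℝ) (ρ : K) (i : Fin 3) :
    (![1, |σ ρ|, (σ ρ) ^ 2] : Fin 3 → ℝ) i ∈ σ.fieldRange := by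
  have h : σ ρ ∈ σ.fieldRange := ⟨ρ, rfl⟩
  fin_cases i
  · exact σ.fieldRange.one_mem
  · rcases abs_choice (σ ρ) with h' | h'
    · change |σ ρ| ∈ σ.fieldRange
      rw [h']
      exact h
    · change |σ ρ| ∈ σ.fieldRange
      rw [h']
      exact σ.fieldRange.neg_mem h
  · exact σ.fieldRange.pow_mem h 2

/-- For `τ = σ(ρ)`, the convergent `βᵢ⁽ᵏ⁾` of the Jacobi--Perron expansion of `(1, |τ|, τ²)`,
as an element of the field `σ(K)`. The indices `i = 0, 1, 2` stand for `β₁, β₂, β₃`. -/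
noncomputable def convergent {K : Type*} [Field K] (σ : K →+* ℝ) (ρ : K) (k : ℕ) (i : Fin 3) :
    σ.fieldRange :=
  ⟨jpa ![1, |σ ρ|, (σ ρ) ^ 2] k i, jpa_mem _ _ (initial_mem σ ρ) k i⟩

/-- The triangle `S` of the elements `λ_{v,w}`. -/
def triangleS {K : Type*} [Field K] (a : ℤ) (ρ : K) : Set K :=
  {x | ∃ v w : ℤ, 1 ≤ v ∧ v ≤ a - 1 ∧ max 1 (v - 1) ≤ w ∧ w ≤ a - 1 ∧
    x = ((-v : ℤ) : K) - ((a * (v - 1) + w : ℤ) : K) * ρ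
      + ((a * (v - 1) + w + 1 : ℤ) : K) * ρ ^ 2}

/-- The triangle `S̃` of the elements `λ̃_{v,u}`. -/
def triangleSTilde {K : Type*} [Field K] (a : ℤ) (ψ : K) : Set K :=
  {x | ∃ v u : ℤ, 1 ≤ v ∧ v ≤ a - 3 ∧ 0 ≤ u ∧ u ≤ v ∧ (v, u) ≠ (1, 0) ∧
    x = ((1 + v - u + a * u : ℤ) : K) + ((a - u + a * u : ℤ) : K) * ψ
      - ((u + 1 : ℤ) : K) * ψ ^ 2}

/-- The lattice `⟨α - β | α, β ∈ T⟩` generated by the differences of elements of `T`. -/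
def differenceLattice (T : Set ℝ) : AddSubgroup ℝ :=
  AddSubgroup.closure {x | ∃ α ∈ T, ∃ β ∈ T, x = α - β}

/-- The translate `x + L` of the lattice `L`. -/
def latticeCoset (x : ℝ) (L : AddSubgroup ℝ) : Set ℝ := {y | ∃ l ∈ L, y = x + l}

/-!
Write `τ` for `σ(ρ)` or `σ(ψ)`. A step of the Jacobi–Perron algorithm is an invertible integral
substitution, so `β₁⁽ᵏ⁾, β₂⁽ᵏ⁾, β₃⁽ᵏ⁾` generate `ℤ[τ]` for every `k`. Each triangle lies in `τ + L`,
where its difference lattice `L` is `⟨1, τ² - mτ⟩` for an integer `m`, and `ℤ[τ] = L ⊕ ℤτ`.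

Suppose `L = ⟨β₁⁽ᵏ⁾ε, β₂⁽ᵏ⁾ε⟩`. As `1 ∈ L`, the inverse of `ε` lies in `ℤ[τ]`, hence so does the
algebraic integer `ε`, and `ℤ[τ] = ℤ[τ]ε = L ⊕ ℤβ₃⁽ᵏ⁾ε`. Now `τ` and `β₃⁽ᵏ⁾ε` both generate the
infinite cyclic group `ℤ[τ] / L`, so they agree up to sign modulo `L`.
-/

theorem closure_insert_eq_sup_zmultiples {G : Type*} [AddGroup G] (x : G) (s : Set G) :
    AddSubgroup.closure (insert x s) = AddSubgroup.closure s ⊔ AddSubgroup.zmultiples x := by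
  rw [Set.insert_eq, AddSubgroup.closure_union, ← AddSubgroup.zmultiples_eq_closure, sup_comm]

theorem closure_pair_sub_sup_zmultiples {G : Type*} [AddCommGroup G] (x y z : G) (m : ℤ) :
    AddSubgroup.closure {y, z - m • x} ⊔ AddSubgroup.zmultiples x =
      AddSubgroup.closure {y, x, z} := by
  rw [← closure_insert_eq_sup_zmultiples, Set.insert_comm y x]
  apply le_antisymm <;>
    simp only [AddSubgroup.closure_le, Set.insert_subset_iff, Set.singleton_subset_iff]
  · have hmem {u : G} (hu : u ∈ ({x, y, z} : Set G)) := AddSubgroup.subset_closure hu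
    exact ⟨hmem (by simp), hmem (by simp), sub_mem (hmem (by simp)) (zsmul_mem (hmem (by simp)) m)⟩
  · have hmem {u : G} (hu : u ∈ ({x, y, z - m • x} : Set G)) := AddSubgroup.subset_closure hu
    have hz := add_mem (hmem (u := z - m • x) (by simp)) (zsmul_mem (hmem (u := x) (by simp)) m)
    rw [sub_add_cancel] at hz
    exact ⟨hmem (by simp), hmem (by simp), hz⟩

theorem closure_range_fin_three {G : Type*} [AddGroup G] (b : Fin 3 → G) :
    AddSubgroup.closure (Set.range b) =
      AddSubgroup.closure {b 0, b 1} ⊔ AddSubgroup.zmultiples (b 2) := by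
  rw [← closure_insert_eq_sup_zmultiples]
  congr 1
  ext
  simp only [Set.mem_range, Fin.exists_fin_succ, Fin.succ_zero_eq_one, Fin.succ_one_eq_two,
    IsEmpty.exists_iff, or_false, Set.mem_insert_iff, Set.mem_singleton_iff]
  tauto

section Index

variable {G : Type*} [AddCommGroup G] {L : AddSubgroup G} {u w : G}

theorem not_isOfFinAddOrder_mk (hu : ∀ n : ℤ, n • u ∈ L → n = 0) :
    ¬IsOfFinAddOrder (u : G ⧸ L) := by
  rw [← injective_zsmul_iff_not_isOfFinAddOrder]
  intro m n (hmn : m • (u : G ⧸ L) = n • (u : G ⧸ L))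
  have hsub : (m - n) • u ∈ L := by
    rw [← QuotientAddGroup.eq_zero_iff, QuotientAddGroup.mk_zsmul, sub_smul, hmn, sub_self]
  exact sub_eq_zero.1 (hu _ hsub)

theorem map_mk_sup_zmultiples (x : G) :
    (L ⊔ AddSubgroup.zmultiples x).map (QuotientAddGroup.mk' L) =
      AddSubgroup.zmultiples (x : G ⧸ L) := by
  rw [AddSubgroup.map_sup, QuotientAddGroup.map_mk'_self, bot_sup_eq, AddMonoidHom.map_zmultiples,
    QuotientAddGroup.mk'_apply]

theorem sub_mem_or_add_mem_of_sup_zmultiples_eq (hu : ∀ n : ℤ, n • u ∈ L → n = 0)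
    (h : L ⊔ AddSubgroup.zmultiples u = L ⊔ AddSubgroup.zmultiples w) :
    u - w ∈ L ∨ u + w ∈ L := by
  have hmap := congrArg (AddSubgroup.map (QuotientAddGroup.mk' L)) h
  rw [map_mk_sup_zmultiples, map_mk_sup_zmultiples,
    AddSubgroup.zmultiples_eq_zmultiples_iff (not_isOfFinAddOrder_mk hu)] at hmap
  rw [← QuotientAddGroup.eq_zero_iff, ← QuotientAddGroup.eq_zero_iff, QuotientAddGroup.mk_sub,
    QuotientAddGroup.mk_add]
  exact hmap.imp sub_eq_zero.2 neg_eq_iff_add_eq_zero.1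

end Index

section Order

variable {F : Type*} [Field F]

theorem mem_of_isIntegral_of_inv_mem {R : Subring F} {x : F} (hx : IsIntegral R x)
    (hinv : x⁻¹ ∈ R) : x ∈ R := by
  rcases eq_or_ne x 0 with rfl | hx0
  · exact R.zero_mem
  have hlocal : IsLocalHom (algebraMap R (integralClosure R F)) :=
    (algebraMap_isIntegral_iff.2 inferInstance).isLocalHom fun y z hyz =>
      Subtype.ext (congrArg (fun w : integralClosure R F => (w : F)) hyz)
  have hunit : IsUnit (algebraMap R (integralClosure R F) ⟨x⁻¹, hinv⟩) :=
    .of_mul_eq_one ⟨x, hx⟩ (Subtype.ext (inv_mul_cancel₀ hx0))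
  obtain ⟨y, hy⟩ := (isUnit_of_map_unit _ _ hunit).exists_right_inv
  have hyx : (y : F) = x := by simpa using eq_inv_of_mul_eq_one_right (congrArg Subtype.val hy)
  exact hyx ▸ y.2

theorem map_mulRight_eq_self {R : Subring F} {e : F} (he : e ∈ R) (hinv : e⁻¹ ∈ R) (he0 : e ≠ 0) :
    R.toAddSubgroup.map (AddMonoidHom.mulRight e) = R.toAddSubgroup := by
  ext x
  constructor
  · rintro ⟨y, hy, rfl⟩
    exact R.mul_mem hy he
  · exact fun hx => ⟨x * e⁻¹, R.mul_mem hx hinv, inv_mul_cancel_right₀ he0 x⟩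

theorem sub_mul_mem_or_add_mul_mem {R : Subring F} {L M : AddSubgroup F} {b e t : F}
    (hLR : L ⊔ AddSubgroup.zmultiples t = R.toAddSubgroup)
    (hMR : M ⊔ AddSubgroup.zmultiples b = R.toAddSubgroup)
    (hL : M.map (AddMonoidHom.mulRight e) = L) (hone : 1 ∈ L) (he : IsIntegral R e)
    (ht : ∀ n : ℤ, n • t ∈ L → n = 0) : t - b * e ∈ L ∨ t + b * e ∈ L := by
  obtain ⟨m, hmM, hme : m * e = 1⟩ := hL ▸ hone
  have hinv : e⁻¹ ∈ R := by
    rw [inv_eq_of_mul_eq_one_left hme, ← Subring.mem_toAddSubgroup, ← hMR]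
    exact AddSubgroup.mem_sup_left hmM
  have hbe : L ⊔ AddSubgroup.zmultiples (b * e) = R.toAddSubgroup := by
    rw [← hL, ← AddMonoidHom.mulRight_apply, ← AddMonoidHom.map_zmultiples, ← AddSubgroup.map_sup,
      hMR]
    exact map_mulRight_eq_self (mem_of_isIntegral_of_inv_mem he hinv) hinv
      (right_ne_zero_of_mul_eq_one hme)
  exact sub_mem_or_add_mem_of_sup_zmultiples_eq ht (hLR.trans hbe.symm)

end Order

section CubicRoot

open Polynomial

theorem irreducible_of_isUnit_coeff_zero {f : ℤ[X]} (hf : f.Monic) (hdeg₂ : 2 ≤ f.natDegree)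
    (hdeg₃ : f.natDegree ≤ 3) (h₀ : IsUnit (f.coeff 0)) (h₁ : f.eval 1 ≠ 0)
    (hneg : f.eval (-1) ≠ 0) : Irreducible f := by
  rw [hf.irreducible_iff_roots_eq_zero_of_degree_le_three hdeg₂ hdeg₃]
  refine Multiset.eq_zero_of_forall_notMem fun x hx => ?_
  have hroot : f.eval x = 0 := isRoot_of_mem_roots hx
  have hdvd : x ∣ f.coeff 0 := by
    simpa [hroot, coeff_zero_eq_eval_zero] using sub_dvd_eval_sub x 0 f
  rcases Int.isUnit_iff.1 (isUnit_of_dvd_unit hdvd h₀) with rfl | rfl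
  · exact h₁ hroot
  · exact hneg hroot

theorem dvd_of_irreducible_of_aeval_eq_zero {R S : Type*} [CommRing R] [IsDomain R]
    [IsIntegrallyClosed R] [CommRing S] [IsDomain S] [Algebra R S] [Module.IsTorsionFree R S]
    {f g : R[X]} {x : S} (hmonic : f.Monic) (hirr : Irreducible f)
    (hf : aeval x f = 0) (hg : aeval x g = 0) : f ∣ g := by
  have hx : IsIntegral R x := ⟨f, hmonic, hf⟩
  have hfmin : f ∣ minpoly R x :=
    (hirr.dvd_iff.1 (minpoly.isIntegrallyClosed_dvd hx hf)).resolve_left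
      (minpoly.not_isUnit R x) |>.dvd
  exact hfmin.trans (minpoly.isIntegrallyClosed_dvd hx hg)

theorem irreducible_cubic {b c : ℤ} (h₁ : b + c ≠ 0) (h₂ : b - c ≠ 2) :
    Irreducible (Cubic.toPoly ⟨1, b, c, -1⟩) := by
  have hdeg : (Cubic.toPoly ⟨1, b, c, -1⟩).natDegree = 3 :=
    Cubic.natDegree_of_a_ne_zero' one_ne_zero
  have heval (x : ℤ) :
      (Cubic.toPoly ⟨1, b, c, -1⟩).eval x = x ^ 3 + b * x ^ 2 + c * x - 1 := by
    simp [Cubic.toPoly, sub_eq_add_neg]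
  refine irreducible_of_isUnit_coeff_zero Cubic.monic_of_a_eq_one' (by lia) hdeg.le ?_ ?_ ?_
  · rw [Cubic.coeff_eq_d]
    exact isUnit_neg_one
  · rw [heval]
    lia
  · rw [heval]
    lia

theorem closure_one_self_sq_eq_adjoin {A : Type*} [Ring A] {f : ℤ[X]} {x : A} (hf : f.Monic)
    (hdeg : f.natDegree = 3) (hfx : aeval x f = 0) :
    AddSubgroup.closure {1, x, x ^ 2} = (Algebra.adjoin ℤ {x}).toSubring.toAddSubgroup := by
  classical
  have hpowers : ((Finset.image (x ^ ·) (Finset.range f.natDegree) : Finset A) : Set A) =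
      {1, x, x ^ 2} := by
    simp [hdeg, Finset.range_add_one, Set.insert_comm, Set.pair_comm]
  rw [← hpowers, ← Submodule.span_int_eq_addSubgroupClosure,
    Submodule.span_range_natDegree_eq_adjoin hf hfx]
  rfl

theorem eq_zero_of_zsmul_mem_closure_quadratic {S : Type*} [CommRing S] [IsDomain S] [CharZero S]
    {f : ℤ[X]} {x : S} (hf : f.Monic) (hirr : Irreducible f) (hdeg : f.natDegree = 3)
    (hfx : aeval x f = 0) {m n : ℤ} (h : n • x ∈ AddSubgroup.closure {1, x ^ 2 - m * x}) :
    n = 0 := by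
  obtain ⟨p, q, hpq⟩ := AddSubgroup.mem_closure_pair.1 h
  simp only [zsmul_eq_mul, mul_one] at hpq
  set g : Cubic ℤ := ⟨0, q, -(q * m) - n, p⟩
  have heval : aeval x g.toPoly = q * x ^ 2 + (-(q * m) - n) * x + p := by
    simp [g, Cubic.toPoly]
  have hgx : aeval x g.toPoly = 0 := by linear_combination heval + hpq
  have hg : g.toPoly = 0 := by
    refine eq_zero_of_dvd_of_natDegree_lt (dvd_of_irreducible_of_aeval_eq_zero hf hirr hfx hgx) ?_
    rw [hdeg]
    exact Nat.lt_succ_of_le (Cubic.natDegree_of_a_eq_zero rfl)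
  have hb : q = 0 := by simpa [hg] using (Cubic.coeff_eq_b (P := g)).symm
  have hc : -(q * m) - n = 0 := by simpa [hg] using (Cubic.coeff_eq_c (P := g)).symm
  simpa [hb] using hc

end CubicRoot

section JacobiPerron

variable {n : ℕ} (β : Fin (n + 1) → ℝ)

theorem closure_range_jpaStep :
    AddSubgroup.closure (Set.range (jpaStep β)) = AddSubgroup.closure (Set.range β) := by
  have hstep (j) : jpaStep β j ∈ AddSubgroup.closure (Set.range (jpaStep β)) :=
    AddSubgroup.subset_closure ⟨j, rfl⟩
  have hβ (j) : β j ∈ AddSubgroup.closure (Set.range β) := AddSubgroup.subset_closure ⟨j, rfl⟩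
  have hlast : jpaStep β (Fin.last n) = β 0 := by rw [jpaStep, Fin.snoc_last]
  have hcast (j : Fin n) :
      jpaStep β j.castSucc = β j.succ - ⌊β j.succ / β 0⌋ • β 0 := by
    rw [jpaStep, Fin.snoc_castSucc, zsmul_eq_mul]
  have hzero : β 0 ∈ AddSubgroup.closure (Set.range (jpaStep β)) := hlast ▸ hstep _
  refine le_antisymm ((AddSubgroup.closure_le _).2 ?_) ((AddSubgroup.closure_le _).2 ?_)
  · rintro _ ⟨i, rfl⟩
    cases i using Fin.lastCases with
    | last => exact hlast ▸ hβ 0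
    | cast j => exact hcast j ▸ sub_mem (hβ _) (zsmul_mem (hβ 0) _)
  · rintro _ ⟨i, rfl⟩
    cases i using Fin.cases with
    | zero => exact hzero
    | succ j => exact (sub_eq_iff_eq_add.1 (hcast j).symm) ▸ add_mem (hstep _) (zsmul_mem hzero _)

theorem closure_range_jpa (k : ℕ) :
    AddSubgroup.closure (Set.range (jpa β k)) = AddSubgroup.closure (Set.range β) := by
  induction k with
  | zero => rfl
  | succ k ih => rw [jpa, Function.iterate_succ_apply', closure_range_jpaStep, ← jpa, ih]

end JacobiPerron

theorem closure_range_one_abs_sq (t : ℝ) :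
    AddSubgroup.closure (Set.range ![1, |t|, t ^ 2]) = AddSubgroup.closure {1, t, t ^ 2} := by
  have hrange : Set.range ![1, |t|, t ^ 2] = {|t|, 1, t ^ 2} := by
    simp only [Matrix.range_cons, Matrix.range_empty, Set.union_empty, Set.singleton_union]
    exact Set.insert_comm 1 |t| {t ^ 2}
  have habs : AddSubgroup.zmultiples |t| = AddSubgroup.zmultiples t := by
    rcases abs_choice t with h | h <;> simp [h]
  rw [hrange, Set.insert_comm 1 t, closure_insert_eq_sup_zmultiples, habs,
    ← closure_insert_eq_sup_zmultiples]

theorem closure_jpa_sup_zmultiples (t : ℝ) (k : ℕ) :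
    AddSubgroup.closure {jpa ![1, |t|, t ^ 2] k 0, jpa ![1, |t|, t ^ 2] k 1} ⊔
        AddSubgroup.zmultiples (jpa ![1, |t|, t ^ 2] k 2) =
      AddSubgroup.closure {1, t, t ^ 2} := by
  rw [← closure_range_fin_three, closure_range_jpa, closure_range_one_abs_sq]

theorem sub_jpa_mul_mem_or_add_jpa_mul_mem {t e : ℝ} {b c m : ℤ}
    (ht : t ^ 3 + b * t ^ 2 + c * t - 1 = 0) (h₁ : b + c ≠ 0) (h₂ : b - c ≠ 2)
    {L : AddSubgroup ℝ} (hL : L = AddSubgroup.closure {1, t ^ 2 - m * t})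
    (he : IsIntegral ℤ e) (k : ℕ)
    (hLe : L = AddSubgroup.closure
      {jpa ![1, |t|, t ^ 2] k 0 * e, jpa ![1, |t|, t ^ 2] k 1 * e}) :
    t - jpa ![1, |t|, t ^ 2] k 2 * e ∈ L ∨ t + jpa ![1, |t|, t ^ 2] k 2 * e ∈ L := by
  have hmonic : (Cubic.toPoly (⟨1, b, c, -1⟩ : Cubic ℤ)).Monic := Cubic.monic_of_a_eq_one'
  have hdeg : (Cubic.toPoly (⟨1, b, c, -1⟩ : Cubic ℤ)).natDegree = 3 :=
    Cubic.natDegree_of_a_ne_zero' one_ne_zero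
  have hroot : Polynomial.aeval t (Cubic.toPoly (⟨1, b, c, -1⟩ : Cubic ℤ)) = 0 := by
    simpa [Cubic.toPoly, sub_eq_add_neg] using ht
  have hadjoin := closure_one_self_sq_eq_adjoin hmonic hdeg hroot
  refine sub_mul_mem_or_add_mul_mem (R := (Algebra.adjoin ℤ {t}).toSubring) ?_
    ((closure_jpa_sup_zmultiples t k).trans hadjoin) ?_ ?_ he.tower_top fun n hn => ?_
  · rw [hL, ← zsmul_eq_mul, closure_pair_sub_sup_zmultiples, hadjoin]
  · rw [hLe, AddMonoidHom.map_closure, Set.image_pair]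
    rfl
  · exact hL ▸ AddSubgroup.subset_closure (Set.mem_insert _ _)
  · exact eq_zero_of_zsmul_mem_closure_quadratic hmonic (irreducible_cubic h₁ h₂) hdeg hroot
      (hL ▸ hn)

section Triangles

theorem mem_latticeCoset_iff {x y : ℝ} {L : AddSubgroup ℝ} : y ∈ latticeCoset x L ↔ y - x ∈ L :=
  ⟨fun ⟨l, hl, h⟩ => by rwa [h, add_sub_cancel_left],
    fun h => ⟨y - x, h, (add_sub_cancel x y).symm⟩⟩

theorem latticeCoset_eq_of_sub_mem {x y : ℝ} {L : AddSubgroup ℝ} (h : x - y ∈ L) :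
    latticeCoset x L = latticeCoset y L := by
  ext z
  rw [mem_latticeCoset_iff, mem_latticeCoset_iff, ← sub_add_sub_cancel z x y,
    L.add_mem_cancel_right h]

theorem sub_mem_differenceLattice {T : Set ℝ} {α β : ℝ} (hα : α ∈ T) (hβ : β ∈ T) :
    α - β ∈ differenceLattice T :=
  AddSubgroup.subset_closure ⟨α, hα, β, hβ, rfl⟩

theorem differenceLattice_le_of_subset_latticeCoset {T : Set ℝ} {x : ℝ} {L : AddSubgroup ℝ}
    (hT : T ⊆ latticeCoset x L) : differenceLattice T ≤ L := by
  rw [differenceLattice, AddSubgroup.closure_le]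
  rintro _ ⟨α, hα, β, hβ, rfl⟩
  rw [SetLike.mem_coe, ← sub_sub_sub_cancel_right α β x]
  exact sub_mem (mem_latticeCoset_iff.1 (hT hα)) (mem_latticeCoset_iff.1 (hT hβ))

variable {K F : Type*} [Field K] [Field F] (σ : K →+* F) (a : ℤ) (x : K)

theorem image_triangleS : σ '' triangleS a x = triangleS a (σ x) := by
  ext y
  constructor
  · rintro ⟨_, ⟨v, w, hv, hv', hw, hw', rfl⟩, rfl⟩
    exact ⟨v, w, hv, hv', hw, hw', by simp⟩
  · rintro ⟨v, w, hv, hv', hw, hw', rfl⟩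
    exact ⟨_, ⟨v, w, hv, hv', hw, hw', rfl⟩, by simp⟩

theorem image_triangleSTilde : σ '' triangleSTilde a x = triangleSTilde a (σ x) := by
  ext y
  constructor
  · rintro ⟨_, ⟨v, u, hv, hv', hu, hu', hvu, rfl⟩, rfl⟩
    exact ⟨v, u, hv, hv', hu, hu', hvu, by simp⟩
  · rintro ⟨v, u, hv, hv', hu, hu', hvu, rfl⟩
    exact ⟨_, ⟨v, u, hv, hv', hu, hu', hvu, rfl⟩, by simp⟩

variable {a} (t : ℝ)

theorem triangleS_subset_latticeCoset :
    triangleS a t ⊆ latticeCoset t (AddSubgroup.closure {1, t ^ 2 - t}) := by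
  rintro _ ⟨v, w, -, -, -, -, rfl⟩
  rw [mem_latticeCoset_iff, AddSubgroup.mem_closure_pair]
  refine ⟨-v, a * (v - 1) + w + 1, ?_⟩
  simp only [zsmul_eq_mul]
  push_cast
  ring

theorem differenceLattice_triangleS (ha : 3 ≤ a) :
    differenceLattice (triangleS a t) = AddSubgroup.closure {1, t ^ 2 - t} := by
  refine le_antisymm
    (differenceLattice_le_of_subset_latticeCoset (triangleS_subset_latticeCoset t)) ?_
  have hmem {v w : ℤ} (hv : 1 ≤ v) (hv' : v ≤ a - 1) (hw : max 1 (v - 1) ≤ w) (hw' : w ≤ a - 1) :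
      ((-v : ℤ) : ℝ) - ((a * (v - 1) + w : ℤ) : ℝ) * t + ((a * (v - 1) + w + 1 : ℤ) : ℝ) * t ^ 2
        ∈ triangleS a t :=
    ⟨v, w, hv, hv', hw, hw', rfl⟩
  have h₁₁ := hmem (v := 1) (w := 1) (by lia) (by lia) (by lia) (by lia)
  have h₁₂ := hmem (v := 1) (w := 2) (by lia) (by lia) (by lia) (by lia)
  have h₂₁ := hmem (v := 2) (w := 1) (by lia) (by lia) (by lia) (by lia)
  have hquad : t ^ 2 - t ∈ differenceLattice (triangleS a t) := by
    convert sub_mem_differenceLattice h₁₂ h₁₁ using 1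
    push_cast
    ring
  have hone : 1 ∈ differenceLattice (triangleS a t) := by
    convert add_mem (sub_mem_differenceLattice h₁₁ h₂₁) (zsmul_mem hquad a) using 1
    rw [zsmul_eq_mul]
    push_cast
    ring
  rw [AddSubgroup.closure_le]
  exact Set.pair_subset hone hquad

theorem triangleSTilde_subset_latticeCoset :
    triangleSTilde a t ⊆ latticeCoset t (AddSubgroup.closure {1, t ^ 2 - (a - 1) * t}) := by
  rintro _ ⟨v, u, -, -, -, -, -, rfl⟩
  rw [mem_latticeCoset_iff, AddSubgroup.mem_closure_pair]
  refine ⟨1 + v - u + a * u, -(u + 1), ?_⟩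
  simp only [zsmul_eq_mul]
  push_cast
  ring

theorem differenceLattice_triangleSTilde (ha : 5 ≤ a) :
    differenceLattice (triangleSTilde a t) =
      AddSubgroup.closure {1, t ^ 2 - (a - 1) * t} := by
  refine le_antisymm
    (differenceLattice_le_of_subset_latticeCoset (triangleSTilde_subset_latticeCoset t)) ?_
  have hmem {v u : ℤ} (hv : v ≤ a - 3) (hu : 1 ≤ u) (hu' : u ≤ v) :
      ((1 + v - u + a * u : ℤ) : ℝ) + ((a - u + a * u : ℤ) : ℝ) * t - ((u + 1 : ℤ) : ℝ) * t ^ 2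
        ∈ triangleSTilde a t :=
    ⟨v, u, by lia, hv, by lia, hu', fun h => by simp only [Prod.mk.injEq] at h; lia, rfl⟩
  have h₁₁ := hmem (v := 1) (u := 1) (by lia) (by lia) (by lia)
  have h₂₁ := hmem (v := 2) (u := 1) (by lia) (by lia) (by lia)
  have h₂₂ := hmem (v := 2) (u := 2) (by lia) (by lia) (by lia)
  have hone : 1 ∈ differenceLattice (triangleSTilde a t) := by
    convert sub_mem_differenceLattice h₂₁ h₁₁ using 1
    push_cast
    ring
  have hquad : t ^ 2 - (a - 1) * t ∈ differenceLattice (triangleSTilde a t) := by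
    convert sub_mem (zsmul_mem hone (a - 1)) (sub_mem_differenceLattice h₂₂ h₂₁) using 1
    rw [zsmul_eq_mul]
    push_cast
    ring
  rw [AddSubgroup.closure_le]
  exact Set.pair_subset hone hquad

end Triangles

theorem exists_integer_subset_latticeCoset {K : Type*} [Field K] {ρ : K} (σ : K →+* ℝ)
    {b c m : ℤ} (hρ : ρ ^ 3 + b * ρ ^ 2 + c * ρ - 1 = 0) (h₁ : b + c ≠ 0) (h₂ : b - c ≠ 2)
    {T : Set ℝ} {L : AddSubgroup ℝ} (hL : L = AddSubgroup.closure {1, σ ρ ^ 2 - m * σ ρ})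
    (hT : T ⊆ latticeCoset (σ ρ) L) (k : ℕ) (ε : 𝓞 K)
    (hε : L = AddSubgroup.closure
      {(convergent σ ρ k 0 : ℝ) * σ ε, (convergent σ ρ k 1 : ℝ) * σ ε}) :
    ∃ η : 𝓞 K, (η = ε ∨ η = -ε) ∧ T ⊆ latticeCoset ((convergent σ ρ k 2 : ℝ) * σ η) L := by
  have ht : σ ρ ^ 3 + b * σ ρ ^ 2 + c * σ ρ - 1 = 0 := by simpa using congrArg σ hρ
  have hint : IsIntegral ℤ (σ ε) := (RingOfIntegers.isIntegral_coe ε).map σ.toIntAlgHom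
  rcases sub_jpa_mul_mem_or_add_jpa_mul_mem ht h₁ h₂ hL hint k hε with h | h
  · exact ⟨ε, .inl rfl, hT.trans_eq (latticeCoset_eq_of_sub_mem h)⟩
  · refine ⟨-ε, .inr rfl, hT.trans_eq (latticeCoset_eq_of_sub_mem ?_)⟩
    simpa [convergent] using h

theorem exists_unit_of_exists_eq_or_eq_neg {R : Type*} [Monoid R] [HasDistribNeg R] {u : Rˣ}
    {p : R → Prop} (h : ∃ x : R, (x = u ∨ x = -u) ∧ p x) : ∃ v : Rˣ, (v = u ∨ v = -u) ∧ p v := by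
  obtain ⟨_, rfl | rfl, hp⟩ := h
  exacts [⟨u, .inl rfl, hp⟩, ⟨-u, .inr rfl, hp⟩]

theorem mainTheorem9_general {K : Type*} [Field K] (a : ℤ) :
    (3 ≤ a → ∀ ρ : K, ρ ^ 3 + ((a : K) - 1) * ρ ^ 2 - (a : K) * ρ - 1 = 0 →
      ∀ (σ : K →+* ℝ) (k : ℕ) (ε : 𝓞 K),
        differenceLattice (σ '' triangleS a ρ) =
          AddSubgroup.closure {(convergent σ ρ k 0 : ℝ) * σ ε, (convergent σ ρ k 1 : ℝ) * σ ε} →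
        ∃ η : 𝓞 K, (η = ε ∨ η = -ε) ∧
          σ '' triangleS a ρ ⊆
            latticeCoset ((convergent σ ρ k 2 : ℝ) * σ η)
              (differenceLattice (σ '' triangleS a ρ))) ∧
    (5 ≤ a → ∀ ψ : K, ψ ^ 3 - ((a : K) - 1) * ψ ^ 2 - (a : K) * ψ - 1 = 0 →
      ∀ (σ : K →+* ℝ) (k : ℕ) (ε : 𝓞 K),
        differenceLattice (σ '' triangleSTilde a ψ) =
          AddSubgroup.closure {(convergent σ ψ k 0 : ℝ) * σ ε, (convergent σ ψ k 1 : ℝ) * σ ε} →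
        ∃ η : 𝓞 K, (η = ε ∨ η = -ε) ∧
          σ '' triangleSTilde a ψ ⊆
            latticeCoset ((convergent σ ψ k 2 : ℝ) * σ η)
              (differenceLattice (σ '' triangleSTilde a ψ))) := by
  refine ⟨fun ha ρ hρ σ k ε hε => ?_, fun ha ψ hψ σ k ε hε => ?_⟩
  · have hroot : ρ ^ 3 + ((a - 1 : ℤ) : K) * ρ ^ 2 + ((-a : ℤ) : K) * ρ - 1 = 0 := by
      push_cast
      linear_combination hρ
    rw [image_triangleS] at hε ⊢
    have hL := differenceLattice_triangleS (σ ρ) ha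
    refine exists_integer_subset_latticeCoset (m := 1) σ hroot (by lia) (by lia) ?_ ?_ k ε hε
    · rw [hL, Int.cast_one, one_mul]
    · exact hL ▸ triangleS_subset_latticeCoset (σ ρ)
  · have hroot : ψ ^ 3 + ((1 - a : ℤ) : K) * ψ ^ 2 + ((-a : ℤ) : K) * ψ - 1 = 0 := by
      push_cast
      linear_combination hψ
    rw [image_triangleSTilde] at hε ⊢
    have hL := differenceLattice_triangleSTilde (σ ψ) ha
    refine exists_integer_subset_latticeCoset (m := a - 1) σ hroot (by lia) (by lia) ?_ ?_ k ε hε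
    · rw [hL, Int.cast_sub, Int.cast_one]
    · exact hL ▸ triangleSTilde_subset_latticeCoset (σ ψ)

theorem mainTheorem9 {K : Type*} [Field K] [NumberField K] (a : ℤ) :
    (3 ≤ a → ∀ ρ : K, ρ ^ 3 + ((a : K) - 1) * ρ ^ 2 - (a : K) * ρ - 1 = 0 →
      IntermediateField.adjoin ℚ {ρ} = ⊤ →
      ∀ (σ : K →+* ℝ) (k : ℕ) (ε : (𝓞 K)ˣ),
        differenceLattice (σ '' triangleS a ρ) =
          AddSubgroup.closure {(convergent σ ρ k 0 : ℝ) * σ ((ε : 𝓞 K) : K),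
            (convergent σ ρ k 1 : ℝ) * σ ((ε : 𝓞 K) : K)} →
        |Algebra.norm ℚ (convergent σ ρ k 2)| ≤ (a : ℚ) ^ 2 - 5 * (a : ℚ) →
        ∃ η : (𝓞 K)ˣ, (η = ε ∨ η = -ε) ∧
          σ '' triangleS a ρ ⊆
            latticeCoset ((convergent σ ρ k 2 : ℝ) * σ ((η : 𝓞 K) : K))
              (differenceLattice (σ '' triangleS a ρ))) ∧
    (5 ≤ a → ∀ ψ : K, ψ ^ 3 - ((a : K) - 1) * ψ ^ 2 - (a : K) * ψ - 1 = 0 →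
      IntermediateField.adjoin ℚ {ψ} = ⊤ →
      ∀ (σ : K →+* ℝ) (k : ℕ) (ε : (𝓞 K)ˣ),
        differenceLattice (σ '' triangleSTilde a ψ) =
          AddSubgroup.closure {(convergent σ ψ k 0 : ℝ) * σ ((ε : 𝓞 K) : K),
            (convergent σ ψ k 1 : ℝ) * σ ((ε : 𝓞 K) : K)} →
        |Algebra.norm ℚ (convergent σ ψ k 2)| ≤ (a : ℚ) ^ 2 - 5 * (a : ℚ) →
        ∃ η : (𝓞 K)ˣ, (η = ε ∨ η = -ε) ∧
          σ '' triangleSTilde a ψ ⊆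
            latticeCoset ((convergent σ ψ k 2 : ℝ) * σ ((η : 𝓞 K) : K))
              (differenceLattice (σ '' triangleSTilde a ψ))) :=
  ⟨fun ha ρ hρ _ σ k ε hε _ =>
      exists_unit_of_exists_eq_or_eq_neg ((mainTheorem9_general a).1 ha ρ hρ σ k ε hε),
    fun ha ψ hψ _ σ k ε hε _ =>
      exists_unit_of_exists_eq_or_eq_neg ((mainTheorem9_general a).2 ha ψ hψ σ k ε hε)⟩
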